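/- A BPP system consists of a finite set $V$ of variables, a finite set $Act$ of actions with a distinguished silent action $\tau\in Act$, and a finite set of rules $X\xrightarrow{a}\gamma$ with $X\in V$, $a\in Act$ and $\gamma$ a finite multiset over $V$. A process is a finite multiset over $V$; writing union of multisets as juxtaposition, each rule $X\xrightarrow{a}\gamma$ induces the steps $X\delta\xrightarrow{a}\gamma\delta$ for all processes $\delta$. Weak steps are $\stackrel{\tau}{\Rightarrow}\;=\;(\xrightarrow{\tau})^*$ and $\stackrel{a}{\Rightarrow}\;=\;(\xrightarrow{\tau})^*\xrightarrow{a}(\xrightarrow{\tau})^*$ for $a\neq\tau$. Weak bisimilarity $\approx$ is the union of all symmetric relations $B$ on processes such that $\alpha\mathrel{B}\beta$ and $\alpha\xrightarrow{a}\alpha'$ with $a\in Act$ imply $\beta\stackrel{a}{\Rightarrow}\beta'$ for some $\beta'$ with $\alpha'\mathrel{B}\beta'$. The long-long approximants $\approx^L_o$ ($o$ an ordinal) are defined by: $\approx^L_0$ relates all pairs of processes; $\alpha\approx^L_{o+1}\beta$ iff for every $a\in Act$, every $\alpha\stackrel{a}{\Rightarrow}\alpha'$ is answered by some $\beta\stackrel{a}{\Rightarrow}\beta'$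 with $\alpha'\approx^L_o\beta'$, and every $\beta\stackrel{a}{\Rightarrow}\beta'$ is answered by some $\alpha\stackrel{a}{\Rightarrow}\alpha'$ with $\alpha'\approx^L_o\beta'$; and $\approx^L_\lambda\;=\;\bigcap_{i<\lambda}\approx^L_i$ for limit ordinals $\lambda$. **Theorem.** The long-long approximants do not stabilize below level $\omega^2$ for BPP: for every finite $k\ge 0$ there is a BPP system in which $\approx\;\neq\;\approx^L_{\omega\cdot k}$. Consequently there is no ordinal $o<\omega^2$ such that $\approx\;=\;\approx^L_o$ holds in every BPP system; in particular, it is not true that $\approx\;=\;\approx^L_{\omega+\omega}$ in every BPP system, which refutes the conjecture of Hirshfeld and Jančar. -/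

import Mathlib

/-- A process description for Basic Parallel Processes (BPP): a finite set `V` of variables, a finite
set `Act` of actions containing the silent action `tau`, and a finite set of rules `X --a--> γ`,
each recorded as a triple `(X, a, γ)` with `γ` a multiset of variables. -/
structure BPP where
  V : Type
  Act : Type
  finite_V : Finite V
  finite_Act : Finite Act
  tau : Act
  rules : Finset (V × Act × Multiset V)

namespace BPP

/-- A process is a finite multiset of variables, read as their parallel composition. -/
abbrev Proc (S : BPP) : Type := Multiset S.V

/-- Strong steps: a rule `X --a--> γ` yields `X δ --a--> γ δ` for every process `δ`. -/
def Step (S : BPP) (a : S.Act) (α β : S.Proc) : Prop :=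
  ∃ (X : S.V) (γ δ : S.Proc), (X, a, γ) ∈ S.rules ∧ α = X ::ₘ δ ∧ β = γ + δ

/-- Finitely many (possibly zero) silent steps. -/
def SilentSteps (S : BPP) : S.Proc → S.Proc → Prop :=
  Relation.ReflTransGen (S.Step S.tau)

/-- Weak steps labelled by a single action: `τ*` for the silent action, and `τ* a τ*` for a
visible action `a`. -/
def WeakStep (S : BPP) (a : S.Act) (α β : S.Proc) : Prop :=
  (a = S.tau ∧ S.SilentSteps α β) ∨
    (a ≠ S.tau ∧ ∃ α' β', S.SilentSteps α α' ∧ S.Step a α' β' ∧ S.SilentSteps β' β)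

/-- Weak bisimulations: symmetric relations in which every strong step is answered by an equally
labelled weak step. -/
def IsWeakBisimulation (S : BPP) (B : S.Proc → S.Proc → Prop) : Prop :=
  (∀ α β, B α β → B β α) ∧
    ∀ α β, B α β → ∀ a α', S.Step a α α' → ∃ β', S.WeakStep a β β' ∧ B α' β'

/-- Weak bisimilarity `≈`. -/
def WeakBisimilar (S : BPP) (α β : S.Proc) : Prop :=
  ∃ B : S.Proc → S.Proc → Prop, S.IsWeakBisimulation B ∧ B α β

/-- The transfinite sequence of approximants of a refinement function `Ψ`: the full relation at `0`,
`Ψ` applied to the previous relation at successors, intersections at limits. -/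
noncomputable def approximant (S : BPP)
    (Ψ : (S.Proc → S.Proc → Prop) → (S.Proc → S.Proc → Prop)) (o : Ordinal.{0}) :
    S.Proc → S.Proc → Prop :=
  Ordinal.limitRecOn (motive := fun _ => S.Proc → S.Proc → Prop) o
    (fun _ _ => True)
    (fun _ R => Ψ R)
    (fun l _ R => fun α β => ∀ (i : Ordinal.{0}) (hi : i < l), R i hi α β)

theorem approximant_zero (S : BPP)
    (Ψ : (S.Proc → S.Proc → Prop) → (S.Proc → S.Proc → Prop)) (α β : S.Proc) :
    S.approximant Ψ 0 α β := by
  simp [approximant]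

theorem approximant_succ (S : BPP)
    (Ψ : (S.Proc → S.Proc → Prop) → (S.Proc → S.Proc → Prop)) (o : Ordinal.{0}) :
    S.approximant Ψ (Order.succ o) = Ψ (S.approximant Ψ o) := by
  simp [approximant]

theorem approximant_limit (S : BPP)
    (Ψ : (S.Proc → S.Proc → Prop) → (S.Proc → S.Proc → Prop)) (o : Ordinal.{0})
    (ho : Order.IsSuccLimit o) (α β : S.Proc) :
    S.approximant Ψ o α β ↔ ∀ i < o, S.approximant Ψ i α β := by
  simp only [approximant]
  rw [Ordinal.limitRecOn_limit _ _ _ _ ho]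

/-- One round of the long-long game: Spoiler picks one of the two processes and makes a weak step
labelled by a single action from it, then Duplicator answers by a weak step with the same label from
the other process, reaching a pair of processes related by `R`. -/
def longLongRefine (S : BPP) (R : S.Proc → S.Proc → Prop) (α β : S.Proc) : Prop :=
  (∀ a α', S.WeakStep a α α' → ∃ β', S.WeakStep a β β' ∧ R α' β') ∧
    (∀ a β', S.WeakStep a β β' → ∃ α', S.WeakStep a α α' ∧ R α' β')

/-- The long-long approximant `≈^L_o`. -/
noncomputable def LongLongApprox (S : BPP) (o : Ordinal.{0}) : S.Proc → S.Proc → Prop :=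
  S.approximant S.longLongRefine o

end BPP

/-!
A generator of level `j` silently spawns variables of any higher level, so next to it those
variables do not matter. The action `drop j` leads from the strong generator of level `j`, and from
a token of level `j`, to the strong generator one level below, but from the other generators only to
the pump one level below.

In the long-long game on the strong against the weak generator of level `j`, Spoiler has to play
`drop j`. Duplicator answers by dropping to the pump and silently pumping any number `n` of tokens
of level `j - 1` within the same weak step. As long as a token is left, Duplicator can answer a drop
by a strong generator too, and every round removes at most one token, so the next drop is useless
for `n` rounds. Since Duplicator chooses `n` after Spoiler has lowered the ordinal, each level is
worth `ω` rounds. Spoiler wins in the end nevertheless: tokens can be consumed, pumps can be frozen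
into weak generators, and at level `0` a weak generator cannot drop at all.
-/

theorem exists_nat_le_of_lt_omega0_mul_add_one {o c : Ordinal} (h : o < Ordinal.omega0 * (c + 1)) :
    ∃ n : ℕ, o ≤ Ordinal.omega0 * c + n := by
  rw [mul_add, mul_one, Ordinal.lt_add_iff Ordinal.omega0_ne_zero] at h
  obtain ⟨d, hd, hod⟩ := h
  obtain ⟨n, rfl⟩ := Ordinal.lt_omega0.1 hd
  exact ⟨n, hod⟩

theorem le_add_natCast_pred_of_add_one_le {o c : Ordinal} {n : ℕ} (h : o + 1 ≤ c + n) :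
    o ≤ c + (n - 1 : ℕ) := by
  cases n with
  | zero => exact le_self_add.trans h
  | succ n =>
    rwa [Nat.cast_add, Nat.cast_one, ← add_assoc, Order.add_one_le_iff,
      Order.lt_add_one_iff] at h

theorem finite_setOf_multiset_card_le (α : Type*) [Finite α] (n : ℕ) :
    {s : Multiset α | s.card ≤ n}.Finite := by
  classical
  have := Fintype.ofFinite α
  refine (Set.finite_Iic (n • (Finset.univ : Finset α).val)).subset fun s hs => ?_
  refine Multiset.le_iff_count.2 fun x => ?_
  simpa using (Multiset.count_le_card x s).trans hs

namespace BPP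

variable {S : BPP} {α β γ : S.Proc} {a : S.Act}

theorem WeakStep.trans_silentSteps (h : S.WeakStep a α β) (h' : S.SilentSteps β γ) :
    S.WeakStep a α γ := by
  rcases h with ⟨ha, h⟩ | ⟨ha, δ, ε, hδ, hε, h⟩
  · exact .inl ⟨ha, h.trans h'⟩
  · exact .inr ⟨ha, δ, ε, hδ, hε, h.trans h'⟩

theorem SilentSteps.trans_weakStep (h : S.SilentSteps α β) (h' : S.WeakStep a β γ) :
    S.WeakStep a α γ := by
  rcases h' with ⟨ha, h'⟩ | ⟨ha, δ, ε, h', hδ, hε⟩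
  · exact .inl ⟨ha, h.trans h'⟩
  · exact .inr ⟨ha, δ, ε, h.trans h', hδ, hε⟩

theorem Step.weakStep (h : S.Step a α β) : S.WeakStep a α β := by
  by_cases ha : a = S.tau
  · subst ha
    exact .inl ⟨rfl, .single h⟩
  · exact .inr ⟨ha, α, β, .refl, h, .refl⟩

theorem weakStep_tau_iff : S.WeakStep S.tau α β ↔ S.SilentSteps α β := by
  simp [WeakStep]

theorem SilentSteps.invariant {P : S.Proc → Prop}
    (hP : ∀ {α β}, S.Step S.tau α β → P α → P β) (h : S.SilentSteps α β) (hα : P α) : P β := by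
  induction h with
  | refl => exact hα
  | tail _ hs ih => exact hP hs ih

theorem WeakStep.invariant {P : S.Proc → Prop} (hτ : ∀ {α β}, S.Step S.tau α β → P α → P β)
    (ha : ∀ {α β}, S.Step a α β → P α → P β) (h : S.WeakStep a α β) (hα : P α) : P β := by
  rcases h with ⟨-, h⟩ | ⟨-, δ, ε, hδ, hε, h⟩
  · exact h.invariant hτ hα
  · exact h.invariant hτ (ha hε (hδ.invariant hτ hα))

theorem WeakBisimilar.symm (h : S.WeakBisimilar α β) : S.WeakBisimilar β α := by
  obtain ⟨B, hB, h⟩ := h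
  exact ⟨B, hB, hB.1 _ _ h⟩

theorem WeakBisimilar.exists_of_step {α' : S.Proc} (h : S.WeakBisimilar α β)
    (hs : S.Step a α α') : ∃ β', S.WeakStep a β β' ∧ S.WeakBisimilar α' β' := by
  obtain ⟨B, hB, h⟩ := h
  obtain ⟨β', hβ, h'⟩ := hB.2 _ _ h _ _ hs
  exact ⟨β', hβ, B, hB, h'⟩

theorem WeakBisimilar.exists_of_silentSteps {α' : S.Proc} (h : S.WeakBisimilar α β)
    (hs : S.SilentSteps α α') : ∃ β', S.SilentSteps β β' ∧ S.WeakBisimilar α' β' := by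
  induction hs with
  | refl => exact ⟨β, .refl, h⟩
  | tail _ hs ih =>
    obtain ⟨β', hβ, h'⟩ := ih
    obtain ⟨β'', hβ', h''⟩ := h'.exists_of_step hs
    exact ⟨β'', hβ.trans (weakStep_tau_iff.1 hβ'), h''⟩

theorem WeakBisimilar.exists_of_weakStep {α' : S.Proc} (h : S.WeakBisimilar α β)
    (hs : S.WeakStep a α α') : ∃ β', S.WeakStep a β β' ∧ S.WeakBisimilar α' β' := by
  rcases hs with ⟨ha, hs⟩ | ⟨-, δ, ε, hδ, hε, hs⟩
  · obtain ⟨β', hβ, h'⟩ := h.exists_of_silentSteps hs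
    exact ⟨β', .inl ⟨ha, hβ⟩, h'⟩
  · obtain ⟨δ', hδ', h⟩ := h.exists_of_silentSteps hδ
    obtain ⟨ε', hε', h⟩ := h.exists_of_step hε
    obtain ⟨β', hβ', h⟩ := h.exists_of_silentSteps hs
    exact ⟨β', (hδ'.trans_weakStep hε').trans_silentSteps hβ', h⟩

theorem longLongApprox_add_one (o : Ordinal.{0}) :
    S.LongLongApprox (o + 1) = S.longLongRefine (S.LongLongApprox o) :=
  S.approximant_succ _ o

theorem WeakBisimilar.longLongApprox (h : S.WeakBisimilar α β) (o : Ordinal.{0}) :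
    S.LongLongApprox o α β := by
  induction o using Ordinal.limitRecOn generalizing α β with
  | zero => exact S.approximant_zero _ _ _
  | add_one o ih =>
    rw [longLongApprox_add_one]
    refine ⟨fun a α' hs => ?_, fun a β' hs => ?_⟩
    · obtain ⟨β', hβ, h'⟩ := h.exists_of_weakStep hs
      exact ⟨β', hβ, ih h'⟩
    · obtain ⟨α', hα, h'⟩ := h.symm.exists_of_weakStep hs
      exact ⟨α', hα, ih h'.symm⟩
  | limit o ho ih => exact (S.approximant_limit _ o ho _ _).2 fun i hi => ih i hi h

/-- A family of relations indexed by ordinals in which Duplicator can answer the steps of the left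
process: a silent step by standing still, at no cost, and a visible step by decreasing the ordinal
or by reaching a weakly bisimilar process. Only strong steps of Spoiler are considered, although the
long-long game has weak ones. -/
structure IsRankedSimulation (S : BPP) (R : Ordinal.{0} → S.Proc → S.Proc → Prop) : Prop where
  silent : ∀ {o α β α'}, R o α β → S.Step S.tau α α' → R o α' β
  visible : ∀ {o a α β α'}, R (o + 1) α β → a ≠ S.tau → S.Step a α α' →
    ∃ β', S.WeakStep a β β' ∧ (R o α' β' ∨ S.WeakBisimilar α' β')

section RankedSimulation

variable {R : Ordinal.{0} → S.Proc → S.Proc → Prop}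

theorem IsRankedSimulation.exists_of_weakStep {o : Ordinal.{0}} {α' : S.Proc}
    (hR : S.IsRankedSimulation R) (mono : ∀ α β, Antitone fun o => R o α β)
    (h : R (o + 1) α β) (hs : S.WeakStep a α α') :
    ∃ β', S.WeakStep a β β' ∧ (R o α' β' ∨ S.WeakBisimilar α' β') := by
  have silent {o : Ordinal.{0}} {α α' β : S.Proc} (hs : S.SilentSteps α α') : R o α β → R o α' β :=
    hs.invariant (P := (R o · β)) fun hs h => hR.silent h hs
  rcases hs with ⟨ha, hs⟩ | ⟨ha, δ, ε, hδ, hε, hs⟩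
  · exact ⟨β, .inl ⟨ha, .refl⟩, .inl (mono _ _ le_self_add (silent hs h))⟩
  · obtain ⟨β', hβ, h | h⟩ := hR.visible (silent hδ h) ha hε
    · exact ⟨β', hβ, .inl (silent hs h)⟩
    · obtain ⟨β'', hβ', h'⟩ := h.exists_of_silentSteps hs
      exact ⟨β'', hβ.trans_silentSteps hβ', .inr h'⟩

theorem IsRankedSimulation.longLongApprox {o : Ordinal.{0}} (hR : S.IsRankedSimulation R)
    (hR' : S.IsRankedSimulation fun o α β => R o β α) (mono : ∀ α β, Antitone fun o => R o α β)
    (h : R o α β) : S.LongLongApprox o α β := by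
  induction o using Ordinal.limitRecOn generalizing α β with
  | zero => exact S.approximant_zero _ _ _
  | limit o ho ih =>
    exact (S.approximant_limit _ o ho _ _).2 fun i hi => ih i hi (mono _ _ hi.le h)
  | add_one o ih =>
    rw [longLongApprox_add_one]
    refine ⟨fun a α' hs => ?_, fun a β' hs => ?_⟩
    · obtain ⟨β', hβ, h'⟩ := hR.exists_of_weakStep mono h hs
      exact ⟨β', hβ, h'.elim ih (·.longLongApprox o)⟩
    · obtain ⟨α', hα, h'⟩ := hR'.exists_of_weakStep (fun α β => mono β α) h hs
      exact ⟨α', hα, h'.elim ih (·.symm.longLongApprox o)⟩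

end RankedSimulation

end BPP

namespace Ladder

/-- The four sorts of variables of the ladder system: three generators and a token. -/
inductive Kind where
  | strong
  | weak
  | pump
  | token

instance : Finite Kind :=
  Finite.of_surjective ![Kind.strong, Kind.weak, Kind.pump, Kind.token] (by
    rintro (_ | _)
    exacts [⟨0, rfl⟩, ⟨1, rfl⟩, ⟨2, rfl⟩, ⟨3, rfl⟩])

/-- The variables of the ladder system: a sort together with a level. -/
abbrev Var (k : ℕ) : Type := Kind × Fin (k + 1)

/-- The actions of the ladder system: at each level a variable may stay at that level or drop to the
one below. -/
inductive Label (k : ℕ) where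
  | tau
  | stay (j : Fin (k + 1))
  | drop (j : Fin (k + 1))

instance (k : ℕ) : Finite (Label k) :=
  Finite.of_surjective
    (fun | none => .tau | some (.inl j) => .stay j | some (.inr j) => .drop j :
      Option (Fin (k + 1) ⊕ Fin (k + 1)) → Label k) (by
    rintro (_ | j | j)
    exacts [⟨none, rfl⟩, ⟨some (.inl j), rfl⟩, ⟨some (.inr j), rfl⟩])

open Order (pred)

/-- The rules of the ladder system with levels `0, …, k`. Since `pred ⊥ = ⊥`, the rule `dropStrong`
keeps a strong generator of level `0` and is the only one for `drop ⊥`; this is what tells it from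
the other generators of level `0`. -/
inductive Rule (k : ℕ) : Var k → Label k → Multiset (Var k) → Prop
  | spawn {x : Kind} (hx : x ≠ .token) {j : Fin (k + 1)} {z : Var k} (hj : j < z.2) :
      Rule k (x, j) .tau {(x, j), z}
  | idle {x : Kind} (hx : x ≠ .token) (j : Fin (k + 1)) : Rule k (x, j) (.stay j) {(x, j)}
  | dropPump {x : Kind} (hx : x ≠ .token) {j : Fin (k + 1)} (hj : j ≠ ⊥) :
      Rule k (x, j) (.drop j) {(.pump, pred j)}
  | dropStrong {x : Kind} (hx : x = .strong ∨ x = .token) (j : Fin (k + 1)) :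
      Rule k (x, j) (.drop j) {(.strong, pred j)}
  | consume (j : Fin (k + 1)) : Rule k (.token, j) (.stay j) 0
  | pump (j : Fin (k + 1)) : Rule k (.pump, j) .tau {(.pump, j), (.token, j)}
  | freeze (j : Fin (k + 1)) : Rule k (.pump, j) .tau {(.weak, j)}

variable {k : ℕ} {a : Label k} {X : Var k} {x : Kind} {j : Fin (k + 1)}
  {p p' q q' η ρ : Multiset (Var k)}

theorem Rule.card_le_two (h : Rule k X a η) : η.card ≤ 2 := by
  cases h <;> simp

theorem finite_setOf_rule (k : ℕ) :
    {r : Var k × Label k × Multiset (Var k) | Rule k r.1 r.2.1 r.2.2}.Finite :=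
  (Set.finite_univ.prod (Set.finite_univ.prod (finite_setOf_multiset_card_le _ 2))).subset
    fun _ h => ⟨trivial, trivial, Rule.card_le_two h⟩

/-- The ladder system with levels `0, …, k`, in which Duplicator survives `ω * k` rounds of the
long-long game on two processes that are not weakly bisimilar. -/
noncomputable abbrev system (k : ℕ) : BPP where
  V := Var k
  Act := Label k
  finite_V := inferInstance
  finite_Act := inferInstance
  tau := .tau
  rules := (finite_setOf_rule k).toFinset

theorem step_iff :
    (system k).Step a p q ↔ ∃ X η ρ, Rule k X a η ∧ p = X ::ₘ ρ ∧ q = η + ρ := by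
  simp [BPP.Step]

theorem Rule.step (h : Rule k X a η) (ρ : Multiset (Var k)) :
    (system k).Step a (X ::ₘ ρ) (η + ρ) :=
  step_iff.2 ⟨X, η, ρ, h, rfl, rfl⟩

/-- All variables of `p` have level at least `j`. -/
def LevelGE (j : Fin (k + 1)) (p : Multiset (Var k)) : Prop := ∀ z ∈ p, j ≤ z.2

/-- Some generator of level `j` occurs in `p`. -/
def HasGen (j : Fin (k + 1)) (p : Multiset (Var k)) : Prop := ∃ x ≠ Kind.token, (x, j) ∈ p

theorem levelGE_cons : LevelGE j (X ::ₘ p) ↔ j ≤ X.2 ∧ LevelGE j p :=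
  Multiset.forall_mem_cons

theorem levelGE_singleton : LevelGE j {X} ↔ j ≤ X.2 := by
  simp [LevelGE]

theorem LevelGE.add (hp : LevelGE j p) (hq : LevelGE j q) : LevelGE j (p + q) :=
  fun z hz => (Multiset.mem_add.1 hz).elim (hp z) (hq z)

theorem LevelGE.mono {i : Fin (k + 1)} (hp : LevelGE j p) (h : i ≤ j) : LevelGE i p :=
  fun z hz => h.trans (hp z hz)

theorem HasGen.mono (hp : HasGen j p) (h : p ≤ q) : HasGen j q :=
  hp.imp fun _ hx => ⟨hx.1, Multiset.mem_of_le h hx.2⟩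

theorem Rule.levelGE (h : Rule k X a η) (ha : a ≠ .drop j) (hj : j ≤ X.2) : LevelGE j η := by
  cases h with
  | spawn hx hz => exact levelGE_cons.2 ⟨hj, levelGE_singleton.2 (hj.trans hz.le)⟩
  | idle hx l => exact levelGE_singleton.2 hj
  | dropPump | dropStrong =>
    exact levelGE_singleton.2 (Order.le_pred_of_lt (hj.lt_of_ne fun h => ha (h ▸ rfl)))
  | consume l => simp [LevelGE]
  | pump l => exact levelGE_cons.2 ⟨hj, levelGE_singleton.2 hj⟩
  | freeze l => exact levelGE_singleton.2 hj

theorem Rule.strong_mem (h : Rule k (.strong, j) a η) (ha : a ≠ .drop j) :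
    (Kind.strong, j) ∈ η := by
  cases h with
  | spawn | idle => simp
  | dropPump | dropStrong => exact absurd rfl ha

theorem Rule.hasGen (h : Rule k (x, j) a η) (hx : x ≠ .token) (ha : a ≠ .drop j) :
    HasGen j η := by
  cases h with
  | spawn | idle => exact ⟨_, hx, by simp⟩
  | dropPump | dropStrong => exact absurd rfl ha
  | consume => exact absurd rfl hx
  | pump => exact ⟨_, hx, by simp⟩
  | freeze => exact ⟨.weak, by simp, by simp⟩

theorem Rule.of_drop (h : Rule k X (.drop j) η) :
    X.2 = j ∧ (j ≠ ⊥ ∧ η = {(.pump, pred j)} ∨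
      (X.1 = .strong ∨ X.1 = .token) ∧ η = {(.strong, pred j)}) := by
  cases h with
  | dropPump _ hj => exact ⟨rfl, .inl ⟨hj, rfl⟩⟩
  | dropStrong hx => exact ⟨rfl, .inr ⟨hx, rfl⟩⟩

theorem Rule.exists_hasGen_le (h : Rule k (x, j) a η) (hx : x ≠ .token) :
    ∃ i ≤ j, HasGen i η := by
  by_cases ha : a = .drop j
  · subst ha
    rcases h.of_drop with ⟨-, ⟨-, rfl⟩ | ⟨-, rfl⟩⟩
    exacts [⟨_, Order.pred_le j, ⟨.pump, by simp, by simp⟩⟩,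
      ⟨_, Order.pred_le j, ⟨.strong, by simp, by simp⟩⟩]
  · exact ⟨j, le_rfl, h.hasGen hx ha⟩

theorem Rule.eq_tau_or_eq_stay (h : Rule k (x, j) a η) (ha : a ≠ .drop j) :
    a = .tau ∨ a = .stay j := by
  cases h <;> simp_all

theorem LevelGE.step (hp : LevelGE j p) (hs : (system k).Step a p p') (ha : a ≠ .drop j) :
    LevelGE j p' := by
  obtain ⟨X, η, ρ, hr, rfl, rfl⟩ := step_iff.1 hs
  exact (hr.levelGE ha (levelGE_cons.1 hp).1).add (levelGE_cons.1 hp).2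

theorem strong_mem_of_step (hp : (Kind.strong, j) ∈ p) (hs : (system k).Step a p p')
    (ha : a ≠ .drop j) : (Kind.strong, j) ∈ p' := by
  obtain ⟨X, η, ρ, hr, rfl, rfl⟩ := step_iff.1 hs
  rcases Multiset.mem_cons.1 hp with rfl | hρ
  · exact Multiset.mem_add.2 (.inl (hr.strong_mem ha))
  · exact Multiset.mem_add.2 (.inr hρ)

theorem HasGen.step (hp : HasGen j p) (hs : (system k).Step a p p') (ha : a ≠ .drop j) :
    HasGen j p' := by
  obtain ⟨X, η, ρ, hr, rfl, rfl⟩ := step_iff.1 hs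
  obtain ⟨x, hx, hm⟩ := hp
  rcases Multiset.mem_cons.1 hm with rfl | hρ
  · exact (hr.hasGen hx ha).mono (Multiset.le_add_right ..)
  · exact ⟨x, hx, Multiset.mem_add.2 (.inr hρ)⟩

theorem HasGen.spawn (hp : HasGen j p) {z : Var k} (hz : j < z.2) :
    (system k).Step .tau p (z ::ₘ p) := by
  obtain ⟨x, hx, hm⟩ := hp
  obtain ⟨ρ, rfl⟩ := Multiset.exists_cons_of_mem hm
  have hs := (Rule.spawn hx hz).step ρ
  rwa [Multiset.insert_eq_cons, Multiset.cons_add, Multiset.singleton_add,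
    Multiset.cons_swap] at hs

theorem HasGen.weakStep (hp : HasGen j p) (hj : j < X.2) (h : Rule k X a η) :
    (system k).WeakStep a p (η + p) :=
  BPP.SilentSteps.trans_weakStep (.single (hp.spawn hj)) (h.step p).weakStep

theorem HasGen.idle (hp : HasGen j p) : (system k).WeakStep (.stay j) p p := by
  obtain ⟨x, hx, hm⟩ := hp
  obtain ⟨ρ, rfl⟩ := Multiset.exists_cons_of_mem hm
  exact ((Rule.idle hx j).step ρ).weakStep

theorem HasGen.exists_dropPump (hp : HasGen j p) (hp' : LevelGE j p) (hj : j ≠ ⊥) :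
    ∃ ρ, LevelGE j ρ ∧ (system k).Step (.drop j) p ((.pump, pred j) ::ₘ ρ) := by
  obtain ⟨x, hx, hm⟩ := hp
  obtain ⟨ρ, rfl⟩ := Multiset.exists_cons_of_mem hm
  exact ⟨ρ, (levelGE_cons.1 hp').2, (Rule.dropPump hx hj).step ρ⟩

theorem exists_dropStrong (hx : x = .strong ∨ x = .token) (hp : (x, j) ∈ p) (hp' : LevelGE j p) :
    ∃ ρ, LevelGE j ρ ∧ (system k).Step (.drop j) p ((.strong, pred j) ::ₘ ρ) := by
  obtain ⟨ρ, rfl⟩ := Multiset.exists_cons_of_mem hp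
  exact ⟨ρ, (levelGE_cons.1 hp').2, (Rule.dropStrong hx j).step ρ⟩

theorem LevelGE.step_drop (hp : LevelGE j p) (hs : (system k).Step (.drop j) p p') :
    ∃ ρ, LevelGE j ρ ∧
      (j ≠ ⊥ ∧ p' = (.pump, pred j) ::ₘ ρ ∨ p' = (.strong, pred j) ::ₘ ρ) := by
  obtain ⟨X, η, ρ, hr, rfl, rfl⟩ := step_iff.1 hs
  refine ⟨ρ, (levelGE_cons.1 hp).2, ?_⟩
  rcases hr.of_drop with ⟨-, ⟨hj, rfl⟩ | ⟨-, rfl⟩⟩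
  exacts [.inl ⟨hj, rfl⟩, .inr rfl]

theorem HasGen.exists_answer (hg : HasGen j q) (hp : LevelGE j p) (hq : LevelGE j q)
    (hs : (system k).Step a p p') (ha : a ≠ .drop j) :
    ∃ q', (system k).WeakStep a q q' ∧ q ≤ q' ∧ LevelGE j q' := by
  obtain ⟨⟨x, l⟩, η, ρ, hr, rfl, rfl⟩ := step_iff.1 hs
  rcases (levelGE_cons.1 hp).1.lt_or_eq with hl | rfl
  · exact ⟨η + q, hg.weakStep hl hr, Multiset.le_add_left .., (hr.levelGE ha hl.le).add hq⟩
  · refine ⟨q, ?_, le_rfl, hq⟩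
    rcases hr.eq_tau_or_eq_stay ha with rfl | rfl
    exacts [.inl ⟨rfl, .refl⟩, hg.idle]

/-- `p` and `q` share a part with a generator of some level `j` and differ only in variables of
higher levels; such processes are weakly bisimilar. -/
def DifferAboveGen (p q : Multiset (Var k)) : Prop :=
  ∃ j δ γ ε, p = δ + γ ∧ q = δ + ε ∧ HasGen j δ ∧ (∀ z ∈ γ, j < z.2) ∧ ∀ z ∈ ε, j < z.2

/-- `p` and `q` contain the strong generator of their common lowest level; such processes are weakly
bisimilar. -/
def ShareStrong (p q : Multiset (Var k)) : Prop :=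
  ∃ j, (Kind.strong, j) ∈ p ∧ (Kind.strong, j) ∈ q ∧ LevelGE j p ∧ LevelGE j q

theorem DifferAboveGen.symm (h : DifferAboveGen p q) : DifferAboveGen q p := by
  obtain ⟨j, δ, γ, γ', hp, hq, hg, hγ, hγ'⟩ := h
  exact ⟨j, δ, γ', γ, hq, hp, hg, hγ', hγ⟩

theorem ShareStrong.symm (h : ShareStrong p q) : ShareStrong q p := by
  obtain ⟨j, hp, hq, hp', hq'⟩ := h
  exact ⟨j, hq, hp, hq', hp'⟩

theorem differAboveGen_pump_cons (hj : j ≠ ⊥) (hp : LevelGE j p) (hq : LevelGE j q) :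
    DifferAboveGen ((.pump, pred j) ::ₘ p) ((.pump, pred j) ::ₘ q) :=
  have hlt : pred j < j := Order.pred_lt_iff_ne_bot.2 hj
  ⟨pred j, {(.pump, pred j)}, p, q, rfl, rfl, ⟨.pump, by simp, by simp⟩,
    fun z hz => hlt.trans_le (hp z hz), fun z hz => hlt.trans_le (hq z hz)⟩

theorem shareStrong_cons (hp : LevelGE j p) (hq : LevelGE j q) :
    ShareStrong ((.strong, pred j) ::ₘ p) ((.strong, pred j) ::ₘ q) :=
  ⟨pred j, by simp, by simp, levelGE_cons.2 ⟨le_rfl, hp.mono (Order.pred_le j)⟩,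
    levelGE_cons.2 ⟨le_rfl, hq.mono (Order.pred_le j)⟩⟩

theorem DifferAboveGen.exists_answer (h : DifferAboveGen p q) (hs : (system k).Step a p p') :
    ∃ q', (system k).WeakStep a q q' ∧ DifferAboveGen p' q' := by
  obtain ⟨j, δ, γ, γ', rfl, rfl, hg, hγ, hγ'⟩ := h
  obtain ⟨X, η, ρ, hr, hp, rfl⟩ := step_iff.1 hs
  rcases Multiset.mem_add.1 (hp ▸ Multiset.mem_cons_self X ρ : X ∈ δ + γ) with hX | hX
  · obtain ⟨δ, rfl⟩ := Multiset.exists_cons_of_mem hX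
    obtain rfl : δ + γ = ρ := by rwa [Multiset.cons_add, Multiset.cons_inj_right] at hp
    have hgen : ∃ i ≤ j, HasGen i (η + δ) := by
      obtain ⟨x, hx, hm⟩ := hg
      rcases Multiset.mem_cons.1 hm with rfl | hm
      · obtain ⟨i, hi, hη⟩ := hr.exists_hasGen_le hx
        exact ⟨i, hi, hη.mono (Multiset.le_add_right ..)⟩
      · exact ⟨j, le_rfl, ⟨x, hx, Multiset.mem_add.2 (.inr hm)⟩⟩
    obtain ⟨i, hi, hη⟩ := hgen
    refine ⟨η + (δ + γ'), ?_, i, η + δ, γ, γ', (add_assoc ..).symm, (add_assoc ..).symm, hη,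
      fun z hz => hi.trans_lt (hγ z hz), fun z hz => hi.trans_lt (hγ' z hz)⟩
    rw [Multiset.cons_add]
    exact (hr.step _).weakStep
  · obtain ⟨γ, rfl⟩ := Multiset.exists_cons_of_mem hX
    obtain rfl : δ + γ = ρ := by rwa [Multiset.add_cons, Multiset.cons_inj_right] at hp
    obtain ⟨hj, hγ⟩ := Multiset.forall_mem_cons.1 hγ
    exact ⟨η + (δ + γ'), (hg.mono (Multiset.le_add_right ..)).weakStep hj hr, j, η + δ, γ, γ',
      (add_assoc ..).symm, (add_assoc ..).symm, hg.mono (Multiset.le_add_left ..), hγ, hγ'⟩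

theorem exists_answer_drop (hx : x = .strong ∨ x = .token) (hxq : (x, j) ∈ q) (hg : HasGen j q)
    (hp : LevelGE j p) (hq : LevelGE j q) (hs : (system k).Step (.drop j) p p') :
    ∃ q', (system k).Step (.drop j) q q' ∧ (DifferAboveGen p' q' ∨ ShareStrong p' q') := by
  obtain ⟨ρ, hρ, ⟨hj, rfl⟩ | rfl⟩ := hp.step_drop hs
  · obtain ⟨σ, hσ, hs'⟩ := hg.exists_dropPump hq hj
    exact ⟨_, hs', .inl (differAboveGen_pump_cons hj hρ hσ)⟩
  · obtain ⟨σ, hσ, hs'⟩ := exists_dropStrong hx hxq hq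
    exact ⟨_, hs', .inr (shareStrong_cons hρ hσ)⟩

theorem ShareStrong.exists_answer (h : ShareStrong p q) (hs : (system k).Step a p p') :
    ∃ q', (system k).WeakStep a q q' ∧ (DifferAboveGen p' q' ∨ ShareStrong p' q') := by
  obtain ⟨j, hp, hq, hp', hq'⟩ := h
  have hg : HasGen j q := ⟨_, by simp, hq⟩
  by_cases ha : a = .drop j
  · subst ha
    exact (exists_answer_drop (.inl rfl) hq hg hp' hq' hs).imp fun _ h => ⟨h.1.weakStep, h.2⟩
  · obtain ⟨r, hr, hle, hr'⟩ := hg.exists_answer hp' hq' hs ha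
    exact ⟨r, hr, .inr ⟨j, strong_mem_of_step hp hs ha, Multiset.mem_of_le hle hq,
      hp'.step hs ha, hr'⟩⟩

theorem isWeakBisimulation (k : ℕ) :
    (system k).IsWeakBisimulation fun p q => DifferAboveGen p q ∨ ShareStrong p q := by
  refine ⟨fun p q h => h.imp .symm .symm, ?_⟩
  rintro p q (h | h) a p' hs
  · exact (h.exists_answer hs).imp fun _ h => ⟨h.1, .inl h.2⟩
  · exact h.exists_answer hs

theorem weakBisimilar_of_differAboveGen_or_shareStrong (h : DifferAboveGen p q ∨ ShareStrong p q) :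
    (system k).WeakBisimilar p q := ⟨_, isWeakBisimulation k, h⟩

theorem replicate_le_of_step_tau {s : ℕ} (h : Multiset.replicate s (Kind.token, j) ≤ p)
    (hs : (system k).Step .tau p p') : Multiset.replicate s (Kind.token, j) ≤ p' := by
  obtain ⟨X, η, ρ, hr, rfl, rfl⟩ := step_iff.1 hs
  have hX : X ≠ (.token, j) := by
    rintro rfl
    cases hr with
    | spawn hx => exact hx rfl
  rw [Multiset.le_cons_of_notMem fun hm => hX (Multiset.eq_of_mem_replicate hm)] at h
  exact h.trans (Multiset.le_add_left ..)

theorem replicate_pred_le_of_step {s : ℕ} (h : Multiset.replicate s (Kind.token, j) ≤ p)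
    (hs : (system k).Step a p p') : Multiset.replicate (s - 1) (Kind.token, j) ≤ p' := by
  obtain ⟨X, η, ρ, -, rfl, rfl⟩ := step_iff.1 hs
  refine le_trans ?_ (Multiset.le_add_left ρ η)
  cases s with
  | zero => exact Multiset.zero_le _
  | succ s =>
    by_cases hX : X = (.token, j)
    · subst hX
      rwa [Multiset.replicate_succ, Multiset.cons_le_cons_iff] at h
    · rw [Multiset.le_cons_of_notMem fun hm => hX (Multiset.eq_of_mem_replicate hm)] at h
      exact ((Multiset.replicate_le_replicate _).2 s.le_succ).trans h

theorem silentSteps_pump (j : Fin (k + 1)) (n : ℕ) (ρ : Multiset (Var k)) :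
    (system k).SilentSteps ((.pump, j) ::ₘ ρ)
      (Multiset.replicate n (Kind.token, j) + (.pump, j) ::ₘ ρ) := by
  induction n with
  | zero =>
    rw [Multiset.replicate_zero, zero_add]
    exact .refl
  | succ n ih =>
    refine ih.tail ?_
    have hs := (Rule.pump j).step (Multiset.replicate n (Kind.token, j) + ρ)
    rwa [← Multiset.add_cons, Multiset.insert_eq_cons, Multiset.cons_add, Multiset.singleton_add,
      Multiset.cons_swap, ← Multiset.add_cons, ← Multiset.cons_add,
      ← Multiset.replicate_succ] at hs

/-- A position of the long-long game in which `p` has the strong generator of level `j` and `q`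
makes up for it by `s` tokens of level `j` and an arbitrary generator of that level. -/
structure Standoff (j : Fin (k + 1)) (s : ℕ) (p q : Multiset (Var k)) : Prop where
  strong_mem : (Kind.strong, j) ∈ p
  levelGE_left : LevelGE j p
  levelGE_right : LevelGE j q
  hasGen : HasGen j q
  replicate_le : Multiset.replicate s (Kind.token, j) ≤ q

namespace Standoff

variable {s : ℕ}

theorem step_tau_left (h : Standoff j s p q) (hs : (system k).Step .tau p p') :
    Standoff j s p' q where
  __ := h
  strong_mem := strong_mem_of_step h.strong_mem hs (by simp)
  levelGE_left := h.levelGE_left.step hs (by simp)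

theorem step_tau_right (h : Standoff j s p q) (hs : (system k).Step .tau q q') :
    Standoff j s p q' where
  __ := h
  levelGE_right := h.levelGE_right.step hs (by simp)
  hasGen := h.hasGen.step hs (by simp)
  replicate_le := replicate_le_of_step_tau h.replicate_le hs

theorem exists_answer_left (h : Standoff j s p q) (hs : (system k).Step a p p')
    (ha : a ≠ .drop j) : ∃ q', (system k).WeakStep a q q' ∧ Standoff j s p' q' := by
  obtain ⟨q', hq, hle, hq'⟩ := h.hasGen.exists_answer h.levelGE_left h.levelGE_right hs ha
  exact ⟨q', hq, strong_mem_of_step h.strong_mem hs ha, h.levelGE_left.step hs ha, hq',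
    h.hasGen.mono hle, h.replicate_le.trans hle⟩

theorem exists_answer_right (h : Standoff j s p q) (hs : (system k).Step a q q')
    (ha : a ≠ .drop j) : ∃ p', (system k).WeakStep a p p' ∧ Standoff j (s - 1) p' q' := by
  have hg : HasGen j p := ⟨_, by simp, h.strong_mem⟩
  obtain ⟨p', hp, hle, hp'⟩ := hg.exists_answer h.levelGE_right h.levelGE_left hs ha
  exact ⟨p', hp, Multiset.mem_of_le hle h.strong_mem, hp', h.levelGE_right.step hs ha,
    h.hasGen.step hs ha, replicate_pred_le_of_step h.replicate_le hs⟩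

theorem exists_answer_drop_right (h : Standoff j s p q) (hs : (system k).Step (.drop j) q q') :
    ∃ p', (system k).WeakStep (.drop j) p p' ∧ (system k).WeakBisimilar q' p' := by
  obtain ⟨p', hp, h'⟩ := exists_answer_drop (.inl rfl) h.strong_mem
    ⟨_, by simp, h.strong_mem⟩ h.levelGE_right h.levelGE_left hs
  exact ⟨p', hp.weakStep, weakBisimilar_of_differAboveGen_or_shareStrong h'⟩

theorem exists_answer_drop_left_of_pos (h : Standoff j s p q) (hs : 0 < s)
    (hp : (system k).Step (.drop j) p p') :
    ∃ q', (system k).WeakStep (.drop j) q q' ∧ (system k).WeakBisimilar p' q' := by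
  have hm : (Kind.token, j) ∈ q :=
    Multiset.mem_of_le h.replicate_le (Multiset.mem_replicate.2 ⟨hs.ne', rfl⟩)
  obtain ⟨q', hq, h'⟩ :=
    exists_answer_drop (.inr rfl) hm h.hasGen h.levelGE_left h.levelGE_right hp
  exact ⟨q', hq.weakStep, weakBisimilar_of_differAboveGen_or_shareStrong h'⟩

theorem exists_answer_drop_left (h : Standoff j s p q) (hj : j ≠ ⊥) (n : ℕ)
    (hp : (system k).Step (.drop j) p p') :
    ∃ q', (system k).WeakStep (.drop j) q q' ∧
      (Standoff (pred j) n p' q' ∨ (system k).WeakBisimilar p' q') := by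
  obtain ⟨σ, hσ, hq⟩ := h.hasGen.exists_dropPump h.levelGE_right hj
  obtain ⟨ρ, hρ, ⟨-, rfl⟩ | rfl⟩ := h.levelGE_left.step_drop hp
  · exact ⟨_, hq.weakStep, .inr (weakBisimilar_of_differAboveGen_or_shareStrong
      (.inl (differAboveGen_pump_cons hj hρ hσ)))⟩
  · have hle := Order.pred_le j
    have standoff : Standoff (pred j) 0 ((.strong, pred j) ::ₘ ρ) ((.pump, pred j) ::ₘ σ) :=
      ⟨by simp, levelGE_cons.2 ⟨le_rfl, hρ.mono hle⟩, levelGE_cons.2 ⟨le_rfl, hσ.mono hle⟩,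
        ⟨.pump, by simp, by simp⟩, by simp⟩
    have hpump := silentSteps_pump (pred j) n σ
    exact ⟨_, hq.weakStep.trans_silentSteps hpump, .inl
      { hpump.invariant (fun hs h => h.step_tau_right hs) standoff with
        replicate_le := Multiset.le_add_right .. }⟩

end Standoff

theorem ne_bot_and_exists_le_of_lt_omega0_mul {o : Ordinal} (h : o < Ordinal.omega0 * (j : ℕ)) :
    j ≠ ⊥ ∧ ∃ n : ℕ, o ≤ Ordinal.omega0 * (pred j : Fin (k + 1)).val + n := by
  cases j using Fin.cases with
  | zero => simp at h
  | succ i =>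
    refine ⟨Fin.succ_ne_zero i, exists_nat_le_of_lt_omega0_mul_add_one ?_⟩
    simpa using h

/-- A standoff which Duplicator can sustain for `o` rounds. -/
def RankedStandoff (o : Ordinal.{0}) (p q : Multiset (Var k)) : Prop :=
  ∃ (j : Fin (k + 1)) (s : ℕ), o ≤ Ordinal.omega0 * (j : ℕ) + s ∧ Standoff j s p q

theorem isRankedSimulation_rankedStandoff (k : ℕ) :
    (system k).IsRankedSimulation RankedStandoff where
  silent := fun ⟨j, s, ho, h⟩ hs => ⟨j, s, ho, h.step_tau_left hs⟩
  visible := by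
    rintro o a p q p' ⟨j, s, ho, h⟩ - hs
    by_cases ha : a = .drop j
    · subst ha
      rcases s.eq_zero_or_pos with rfl | hpos
      · obtain ⟨hj, n, hn⟩ := ne_bot_and_exists_le_of_lt_omega0_mul (j := j) (o := o)
          (by simpa [Order.add_one_le_iff] using ho)
        obtain ⟨q', hq, h'⟩ := h.exists_answer_drop_left hj n hs
        exact ⟨q', hq, h'.imp_left fun h' => ⟨_, n, hn, h'⟩⟩
      · obtain ⟨q', hq, h'⟩ := h.exists_answer_drop_left_of_pos hpos hs
        exact ⟨q', hq, .inr h'⟩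
    · obtain ⟨q', hq, h'⟩ := h.exists_answer_left hs ha
      exact ⟨q', hq, .inl ⟨j, s, le_self_add.trans ho, h'⟩⟩

theorem isRankedSimulation_rankedStandoff_swap (k : ℕ) :
    (system k).IsRankedSimulation fun o p q => RankedStandoff o q p where
  silent := fun ⟨j, s, ho, h⟩ hs => ⟨j, s, ho, h.step_tau_right hs⟩
  visible := by
    rintro o a q p q' ⟨j, s, ho, h⟩ - hs
    by_cases ha : a = .drop j
    · subst ha
      obtain ⟨p', hp, h'⟩ := h.exists_answer_drop_right hs
      exact ⟨p', hp, .inr h'⟩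
    · obtain ⟨p', hp, h'⟩ := h.exists_answer_right hs ha
      exact ⟨p', hp, .inl ⟨j, s - 1, le_add_natCast_pred_of_add_one_le ho, h'⟩⟩

theorem RankedStandoff.longLongApprox {o : Ordinal.{0}} (h : RankedStandoff o p q) :
    (system k).LongLongApprox o p q :=
  (isRankedSimulation_rankedStandoff k).longLongApprox (isRankedSimulation_rankedStandoff_swap k)
    (fun _ _ _ _ hle ⟨j, s, ho, h⟩ => ⟨j, s, hle.trans ho, h⟩) h

/-- All variables of `p` have level at least `j`, and the strong generator of level `j` does not
occur: the positions Duplicator loses against the strong generator of level `j`. -/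
def NoStrong (j : Fin (k + 1)) (p : Multiset (Var k)) : Prop :=
  LevelGE j p ∧ (Kind.strong, j) ∉ p

/-- Apart from weak generators of level `j`, all variables of `p` have level above `j`: a position
without strong generator of level `j` in which tokens and pumps have been used up. -/
def Spent (j : Fin (k + 1)) (p : Multiset (Var k)) : Prop := ∀ z ∈ p, z = (.weak, j) ∨ j < z.2

theorem Spent.cons (hX : X = (.weak, j) ∨ j < X.2) (hp : Spent j p) : Spent j (X ::ₘ p) :=
  Multiset.forall_mem_cons.2 ⟨hX, hp⟩

theorem Spent.levelGE (hp : Spent j p) : LevelGE j p := by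
  intro z hz
  rcases hp z hz with rfl | h
  exacts [le_rfl, h.le]

theorem Spent.step_tau (hp : Spent j p) (hs : (system k).Step .tau p p') : Spent j p' := by
  obtain ⟨X, η, ρ, hr, rfl, rfl⟩ := step_iff.1 hs
  obtain ⟨hX, hρ⟩ := Multiset.forall_mem_cons.1 hp
  intro z hz
  refine (Multiset.mem_add.1 hz).elim (fun hz => ?_) (hρ z)
  rcases hX with rfl | hX
  · cases hr with
    | spawn _ hw =>
      simp only [Multiset.insert_eq_cons, Multiset.mem_cons, Multiset.mem_singleton] at hz
      rcases hz with rfl | rfl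
      exacts [.inl rfl, .inr hw]
  · exact .inr (hX.trans_le (hr.levelGE (by simp) le_rfl z hz))

theorem NoStrong.step_tau (hp : NoStrong j p) (hs : (system k).Step .tau p p') :
    NoStrong j p' := by
  refine ⟨hp.1.step hs (by simp), fun hm => ?_⟩
  obtain ⟨X, η, ρ, hr, rfl, rfl⟩ := step_iff.1 hs
  have hX : X ≠ (.strong, j) := fun h => hp.2 (h ▸ Multiset.mem_cons_self ..)
  refine (Multiset.mem_add.1 hm).elim (fun hm => ?_) fun hm => hp.2 (Multiset.mem_cons_of_mem hm)
  cases hr with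
  | spawn hx hz =>
    simp only [Multiset.insert_eq_cons, Multiset.mem_cons, Multiset.mem_singleton] at hm
    rcases hm with hm | rfl
    exacts [hX hm.symm, hz.not_ge (levelGE_cons.1 hp.1).1]
  | pump | freeze => simp at hm

theorem Spent.step_drop (hp : Spent j p) (hs : (system k).Step (.drop j) p p') :
    j ≠ ⊥ ∧ NoStrong (pred j) p' := by
  obtain ⟨X, η, ρ, hr, rfl, rfl⟩ := step_iff.1 hs
  obtain ⟨hX, hρ⟩ := Multiset.forall_mem_cons.1 hp
  obtain ⟨hXj, ⟨hj, rfl⟩ | ⟨hX', -⟩⟩ := hr.of_drop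
  · have hlt : pred j < j := Order.pred_lt_iff_ne_bot.2 hj
    refine ⟨hj, levelGE_cons.2 ⟨le_rfl, (Spent.levelGE hρ).mono hlt.le⟩, fun hm => ?_⟩
    rcases Multiset.mem_cons.1 hm with hm | hm
    · simp at hm
    · exact hlt.not_ge (Spent.levelGE hρ _ hm)
  · rcases hX with rfl | hX
    · simp at hX'
    · exact absurd hXj hX.ne'

theorem Spent.weakStep_drop (hp : Spent j p) (hs : (system k).WeakStep (.drop j) p p') :
    j ≠ ⊥ ∧ NoStrong (pred j) p' := by
  obtain ⟨h, -⟩ | ⟨-, q, q', hq, hs, hq'⟩ := hs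
  · simp at h
  · have hspent : Spent j q := hq.invariant (fun hs h => h.step_tau hs) hp
    obtain ⟨hj, hq''⟩ := hspent.step_drop hs
    exact ⟨hj, hq'.invariant (fun hs h => h.step_tau hs) hq''⟩

theorem strong_mem_of_weakStep (hp : (Kind.strong, j) ∈ p) (hs : (system k).WeakStep a p p')
    (ha : a ≠ .drop j) : (Kind.strong, j) ∈ p' :=
  hs.invariant (P := fun r : Multiset (Var k) => (Kind.strong, j) ∈ r)
    (fun hs hm => strong_mem_of_step hm hs (by simp)) (fun hs hm => strong_mem_of_step hm hs ha) hp

theorem NoStrong.exists_eq_add (hp : NoStrong j p) :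
    ∃ σ ρ, p = σ + ρ ∧ (∀ z ∈ σ, z = (.token, j) ∨ z = (.pump, j)) ∧ Spent j ρ := by
  classical
  refine ⟨_, _, (Multiset.filter_add_not (fun z => z = (.token, j) ∨ z = (.pump, j)) p).symm,
    fun z hz => (Multiset.mem_filter.1 hz).2, ?_⟩
  rintro ⟨x, l⟩ hz
  obtain ⟨hz, hn⟩ := Multiset.mem_filter.1 hz
  rcases (hp.1 _ hz).lt_or_eq with h | rfl
  · exact .inr h
  · cases x with
    | strong => exact absurd hz hp.2
    | weak => exact .inl rfl
    | pump | token => simp at hn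

theorem exists_weakBisimilar_spent {σ : Multiset (Var k)} (hp : (Kind.strong, j) ∈ p)
    (hσ : ∀ z ∈ σ, z = (.token, j) ∨ z = (.pump, j)) (hρ : Spent j ρ)
    (h : (system k).WeakBisimilar p (σ + ρ)) :
    ∃ p' q', (Kind.strong, j) ∈ p' ∧ Spent j q' ∧ (system k).WeakBisimilar p' q' := by
  induction σ using Multiset.induction_on generalizing p ρ with
  | empty => exact ⟨p, ρ, hp, hρ, by rwa [zero_add] at h⟩
  | cons z σ ih =>
    rw [Multiset.cons_add] at h
    obtain ⟨hz, hσ'⟩ := Multiset.forall_mem_cons.1 hσ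
    rcases hz with rfl | rfl
    · obtain ⟨p', hp', h'⟩ := h.symm.exists_of_step ((Rule.consume j).step (σ + ρ))
      rw [zero_add] at h'
      exact ih (strong_mem_of_weakStep hp hp' (by simp)) hσ' hρ h'.symm
    · obtain ⟨p', hp', h'⟩ := h.symm.exists_of_step ((Rule.freeze j).step (σ + ρ))
      rw [Multiset.singleton_add, ← Multiset.add_cons] at h'
      exact ih (strong_mem_of_weakStep hp hp' (by simp)) hσ' (hρ.cons (.inl rfl)) h'.symm

theorem NoStrong.not_weakBisimilar (hq : NoStrong j q) (hp : (Kind.strong, j) ∈ p) :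
    ¬ (system k).WeakBisimilar p q := by
  induction j using WellFoundedLT.induction generalizing p q with
  | _ j ih =>
    intro h
    obtain ⟨σ, ρ, rfl, hσ, hρ⟩ := hq.exists_eq_add
    obtain ⟨p, q, hp, hq, h⟩ := exists_weakBisimilar_spent hp hσ hρ h
    obtain ⟨p, rfl⟩ := Multiset.exists_cons_of_mem hp
    obtain ⟨q', hs, h'⟩ := h.exists_of_step ((Rule.dropStrong (.inl rfl) j).step p)
    obtain ⟨hj, hq'⟩ := hq.weakStep_drop hs
    exact ih (pred j) (Order.pred_lt_iff_ne_bot.2 hj) hq' (by simp) h'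

theorem weakBisimilar_ne_longLongApprox (k : ℕ) {o : Ordinal.{0}} (ho : o ≤ Ordinal.omega0 * k) :
    (system k).WeakBisimilar ≠ (system k).LongLongApprox o := by
  intro h
  have hlevel (x : Kind) : LevelGE (Fin.last k) {(x, Fin.last k)} := levelGE_singleton.2 le_rfl
  have hrank : RankedStandoff o {(.strong, Fin.last k)} {(.weak, Fin.last k)} :=
    ⟨Fin.last k, 0, by simpa using ho, by simp, hlevel _, hlevel _,
      ⟨.weak, by simp, by simp⟩, by simp⟩
  have hnot : NoStrong (Fin.last k) {(.weak, Fin.last k)} := ⟨hlevel _, by simp⟩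
  exact hnot.not_weakBisimilar (by simp) (h ▸ hrank.longLongApprox)

end Ladder

theorem mainTheorem1 :
    (∀ k : ℕ, ∃ S : BPP, S.WeakBisimilar ≠ S.LongLongApprox (Ordinal.omega0 * (k : Ordinal.{0}))) ∧
    (∀ o : Ordinal.{0}, o < Ordinal.omega0 * Ordinal.omega0 →
      ¬ ∀ S : BPP, S.WeakBisimilar = S.LongLongApprox o) ∧
    (¬ ∀ S : BPP, S.WeakBisimilar = S.LongLongApprox (Ordinal.omega0 + Ordinal.omega0)) := by
  have not_stable {o : Ordinal.{0}} (ho : o < Ordinal.omega0 * Ordinal.omega0) :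
      ¬ ∀ S : BPP, S.WeakBisimilar = S.LongLongApprox o := by
    intro h
    obtain ⟨c, hc, hlt⟩ := (Ordinal.lt_mul_iff_of_isSuccLimit Ordinal.isSuccLimit_omega0).1 ho
    obtain ⟨k, rfl⟩ := Ordinal.lt_omega0.1 hc
    exact Ladder.weakBisimilar_ne_longLongApprox k hlt.le (h _)
  have omega0_add_omega0_lt : Ordinal.omega0 + Ordinal.omega0 <
      Ordinal.omega0 * Ordinal.omega0.{0} := by
    rw [← Ordinal.mul_two]
    exact mul_lt_mul_of_pos_left (Ordinal.natCast_lt_omega0 2) Ordinal.omega0_pos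
  exact ⟨fun k => ⟨_, Ladder.weakBisimilar_ne_longLongApprox k le_rfl⟩, fun _ => not_stable,
    not_stable omega0_add_omega0_lt⟩
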